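/- Let $n\ge 3$, $\gamma>0$, $A>0$. For a positive function $w(\xi,\tau)$ put $$I[w]=e^{-\gamma\tau}\bigl(w_\tau-(1+\gamma)w\bigr)-(n-1)\Bigl(\frac{w_{\xi\xi}}{w}+\frac{n-6}{4}\frac{w_\xi^2}{w^2}\Bigr)+(n-1)(n-2)-\gamma A\,w_\xi .$$ The equation $I[w]=0$ is called the inner equation. A positive $C^2$ function $w$ is called a super-solution (resp. sub-solution) of the inner equation on an open set if $I[w]>0$ (resp. $I[w]<0$) at every point of that set. Let $\bar w_0:\mathbb R\to(0,\infty)$ be the entire positive ($C^2$) solution of $$(n-1)\Bigl(\frac{\bar w_0''}{\bar w_0}+\frac{n-6}{4}\frac{(\bar w_0')^2}{\bar w_0^2}\Bigr)-(n-1)(n-2)+\gamma A\,\bar w_0'=0$$ normalized by $$\bar w_0(\xi)=\frac{(n-1)(n-2)}{\gamma A}\,\xi+\frac{(n-1)(n-6)}{4\gamma A}\,\frac1\xi+O\Bigl(\frac1{\xi^2}\Bigr)\qquad(\xi\to+\infty).$$ **Proposition.** Let $0<\epsilon<1$ and $\tau_0,M,\xi_1\in\mathbb R$. (a) For every $K\in\mathbb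 R$ there is $\tau_1=\tau_1(\epsilon,M,\xi_1,\tau_0,K)\ge\tau_0$ such that for every smooth function $C_1$ on $[\tau_0,\infty)$ with $|C_1'(\tau)|\le M$ for all $\tau\ge\tau_0$ and $C_1(\tau_0)\le K$, the function $$\bar w^+(\xi,\tau)=\frac1{1+\epsilon}\,\bar w_0(\xi+C_1(\tau))$$ is a super-solution of the inner equation on $(-\infty,\xi_1)\times(\tau_1,\infty)$. (b) There is $\tau_1=\tau_1(\epsilon,M,\xi_1,\tau_0)\ge\tau_0$ such that for every smooth function $C_2$ on $[\tau_0,\infty)$ with $|C_2'(\tau)|\le M$ for all $\tau\ge\tau_0$, the function $$\bar w^-(\xi,\tau)=\frac1{1-\epsilon}\,\bar w_0(\xi+C_2(\tau))$$ is a sub-solution of the inner equation on $(-\infty,\xi_1)\times(\tau_1,\infty)$. (Here $\tau_1$ may also depend on the fixed parameters $n,\gamma,A$. In particular, for given $C_1,C_2$ with $|C_1'|,|C_2'|\le M$ on $[\tau_0,\infty)$, a single $\tau_1$ works for both.) -/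

import Mathlib

open scoped ContDiff
open Asymptotics Filter Set

noncomputable section

/-- The inner region operator
`I[w] = e^{-γτ} (w_τ - (1+γ) w) - (n-1) (w_ξξ / w + (n-6)/4 * w_ξ² / w²) + (n-1)(n-2) - γ A w_ξ`
evaluated at `(ξ, τ)`, for a function `w` of `ξ` (first argument) and `τ` (second argument). -/
def innerOp (n : ℕ) (γ A : ℝ) (w : ℝ → ℝ → ℝ) (ξ τ : ℝ) : ℝ :=
  Real.exp (-γ * τ) * (deriv (fun t => w ξ t) τ - (1 + γ) * w ξ τ)
    - ((n : ℝ) - 1) * (deriv (deriv (fun x => w x τ)) ξ / w ξ τ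
        + ((n : ℝ) - 6) / 4 * (deriv (fun x => w x τ) ξ ^ 2 / w ξ τ ^ 2))
    + ((n : ℝ) - 1) * ((n : ℝ) - 2) - γ * A * deriv (fun x => w x τ) ξ

/-- The inner region approximation (the steady soliton in cylindrical coordinates): the positive
entire solution of
`(n-1) (w'' / w + (n-6)/4 * w'² / w²) - (n-1)(n-2) + γ A w' = 0`, normalized among its
translates by
`w(ξ) = (n-1)(n-2)/(γA) * ξ + 0 + (n-1)(n-6)/(4γA) * 1/ξ + O(1/ξ²)` as `ξ → +∞`. -/
structure IsInnerProfile (n : ℕ) (γ A : ℝ) (w : ℝ → ℝ) : Prop where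
  contDiff : ContDiff ℝ 2 w
  pos : ∀ ξ, 0 < w ξ
  ode : ∀ ξ, ((n : ℝ) - 1) * (deriv (deriv w) ξ / w ξ
        + ((n : ℝ) - 6) / 4 * (deriv w ξ ^ 2 / w ξ ^ 2))
      - ((n : ℝ) - 1) * ((n : ℝ) - 2) + γ * A * deriv w ξ = 0
  asymptotics :
    (fun ξ : ℝ => w ξ - (((n : ℝ) - 1) * ((n : ℝ) - 2) / (γ * A) * ξ
        + ((n : ℝ) - 1) * ((n : ℝ) - 6) / (4 * γ * A) * (1 / ξ)))
      =O[atTop] (fun ξ : ℝ => 1 / ξ ^ 2)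

/-- A (strict, classical) super-solution of `I[w] = 0` on a region `U` of the `(ξ, τ)`-plane:
a positive `C²` function with `I[w] > 0` on `U`. -/
structure IsInnerSuperSolutionOn (n : ℕ) (γ A : ℝ) (w : ℝ → ℝ → ℝ) (U : Set (ℝ × ℝ)) :
    Prop where
  contDiffOn : ContDiffOn ℝ 2 (fun p : ℝ × ℝ => w p.1 p.2) U
  pos : ∀ p ∈ U, 0 < w p.1 p.2
  innerOp_pos : ∀ p ∈ U, 0 < innerOp n γ A w p.1 p.2

/-- A (strict, classical) sub-solution of `I[w] = 0` on a region `U` of the `(ξ, τ)`-plane: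
a positive `C²` function with `I[w] < 0` on `U`. -/
structure IsInnerSubSolutionOn (n : ℕ) (γ A : ℝ) (w : ℝ → ℝ → ℝ) (U : Set (ℝ × ℝ)) :
    Prop where
  contDiffOn : ContDiffOn ℝ 2 (fun p : ℝ × ℝ => w p.1 p.2) U
  pos : ∀ p ∈ U, 0 < w p.1 p.2
  innerOp_neg : ∀ p ∈ U, innerOp n γ A w p.1 p.2 < 0

/-- The upper barrier `w⁺(ξ, τ) = w₀(ξ + C(τ)) / (1 + ε)`. -/
def upperBarrier (w₀ : ℝ → ℝ) (ε : ℝ) (C : ℝ → ℝ) (ξ τ : ℝ) : ℝ :=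
  1 / (1 + ε) * w₀ (ξ + C τ)

/-- The lower barrier `w⁻(ξ, τ) = w₀(ξ + C(τ)) / (1 - ε)`. -/
def lowerBarrier (w₀ : ℝ → ℝ) (ε : ℝ) (C : ℝ → ℝ) (ξ τ : ℝ) : ℝ :=
  1 / (1 - ε) * w₀ (ξ + C τ)

/-- `C` is a smooth function on `[τ₀, ∞)` with `|C'| ≤ M` there (one-sided derivative at `τ₀`). -/
def IsSlowShift (τ₀ M : ℝ) (C : ℝ → ℝ) : Prop :=
  ContDiffOn ℝ ∞ C (Ici τ₀) ∧ ∀ τ ∈ Ici τ₀, |derivWithin C (Ici τ₀) τ| ≤ M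

end

/-! The quotients `w'' / w` and `w'² / w²` do not change when `w` is multiplied by a constant `c`,
so the profile equation reduces `I[c w₀(ξ + C)]` to `c e^{-γτ} (C' w₀' - (1+γ) w₀) + γA (1-c) w₀'`
(`innerOp_eq`). Since `w₀' > 0` (`deriv_pos`), the last term has the sign of `1 - c`, and it must
dominate the exponentially small one. For the sub-solution, `-(1+γ) w₀` has the right sign and `|C'|
≤ M` suffices. For the super-solution, `w₀` must be controlled by `w₀'`: `exists_le_mul_deriv` gives
`w₀ ≤ B (1+r) w₀'` on `(-∞, r]`. As `C` grows at most linearly, so does the required `r`, and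
`e^{-γτ}` wins. This bound comes from comparison arguments for the Riccati-type equation of `w₀' /
w₀`. -/

open scoped Topology

/-! ### Scalar comparison lemmas -/

/-- A function that is nonnegative at `a` and increasing at each of its zeros to the right of `a`
stays nonnegative to the right of `a`. -/
theorem nonneg_of_deriv_pos_at_zeros {f f' : ℝ → ℝ} {a : ℝ} (hf : ∀ x, a ≤ x → HasDerivAt f (f' x) x)
    (ha : 0 ≤ f a) (h : ∀ x, a ≤ x → f x = 0 → 0 < f' x) {x : ℝ} (hx : a ≤ x) : 0 ≤ f x := by
  have key := image_le_of_deriv_right_lt_deriv_boundary' (f := fun y => - f y)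
    (f' := fun y => - f' y) (a := a) (b := x) (B := fun _ => 0) (B' := fun _ => 0)
    (fun y hy => (hf y hy.1).neg.continuousAt.continuousWithinAt)
    (fun y hy => (hf y hy.1).neg.hasDerivWithinAt) (by simpa using ha) continuousOn_const
    (fun y _ => hasDerivWithinAt_const y _ _)
    (fun y hy h0 => by have := h y hy.1 (by linarith); linarith) (right_mem_Icc.2 hx)
  linarith

/-- A function that is nonnegative at `a` and decreasing at each of its zeros to the left of `a`
is nonnegative to the left of `a`. -/
theorem nonneg_of_deriv_neg_at_zeros {f f' : ℝ → ℝ} {a : ℝ} (hf : ∀ x, x ≤ a → HasDerivAt f (f' x) x)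
    (ha : 0 ≤ f a) (h : ∀ x, x ≤ a → f x = 0 → f' x < 0) {x : ℝ} (hx : x ≤ a) : 0 ≤ f x := by
  have key := nonneg_of_deriv_pos_at_zeros (f := fun y => f (-y)) (f' := fun y => - f' (-y))
    (a := -a) (x := -x)
    (fun y hy => by
      have h1 := (hf (-y) (by linarith)).scomp y (hasDerivAt_neg y)
      exact h1.congr_deriv (by simp))
    (by simpa using ha) (fun y hy h0 => by have := h (-y) (by linarith) h0; linarith)
    (by linarith)
  simpa using key

/-- A function whose derivative is bounded below by a positive constant on `(-∞, a]` is negative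
somewhere. -/
theorem exists_neg_of_le_deriv {f f' : ℝ → ℝ} {a c : ℝ} (hf : ∀ x, x ≤ a → HasDerivAt f (f' x) x)
    (hc : 0 < c) (h : ∀ x, x ≤ a → c ≤ f' x) : ∃ x ≤ a, f x < 0 := by
  refine ⟨a - (|f a| + 1) / c, by have : 0 < (|f a| + 1) / c := by positivity
                                  linarith, ?_⟩
  set x := a - (|f a| + 1) / c with hx
  have hxa : x ≤ a := by
    have : 0 < (|f a| + 1) / c := by positivity
    linarith
  have hint : ∀ y ∈ interior (Iic a), y ≤ a := fun y hy => mem_Iic.1 (interior_subset hy)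
  have h1 := Convex.mul_sub_le_image_sub_of_le_deriv (convex_Iic a) (f := f) (C := c)
    (fun y hy => (hf y hy).continuousAt.continuousWithinAt)
    (fun y hy => (hf y (hint y hy)).differentiableAt.differentiableWithinAt)
    (fun y hy => by rw [(hf y (hint y hy)).deriv]; exact h y (hint y hy))
    x hxa a self_mem_Iic hxa
  have h2 : c * (a - x) = |f a| + 1 := by rw [hx]; field_simp; ring
  linarith [le_abs_self (f a)]

/-! ### Equations for `1 / w` and `w' / w`; monotonicity of the profile -/

namespace IsInnerProfile

variable {n : ℕ} {γ A : ℝ} {w : ℝ → ℝ}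

theorem hasDerivAt (hw : IsInnerProfile n γ A w) (x : ℝ) : HasDerivAt w (deriv w x) x :=
  (hw.contDiff.differentiable (by norm_num) x).hasDerivAt

theorem hasDerivAt_deriv (hw : IsInnerProfile n γ A w) (x : ℝ) :
    HasDerivAt (deriv w) (deriv (deriv w) x) x :=
  ((hw.contDiff.differentiable_deriv_two) x).hasDerivAt

theorem deriv_deriv_eq (hw : IsInnerProfile n γ A w) (hn : 3 ≤ n) (x : ℝ) :
    deriv (deriv w) x = ((n : ℝ) - 2) * w x - γ * A / ((n : ℝ) - 1) * w x * deriv w x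
      - ((n : ℝ) - 6) / 4 * (deriv w x ^ 2 / w x) := by
  have h := hw.ode x
  have h0 := (hw.pos x).ne'
  have hn' : (3 : ℝ) ≤ n := by exact_mod_cast hn
  have h1 : (n : ℝ) - 1 ≠ 0 := by linarith
  field_simp at h ⊢
  linear_combination h

theorem hasDerivAt_inv (hw : IsInnerProfile n γ A w) (x : ℝ) :
    HasDerivAt (fun y => (w y)⁻¹) (-deriv w x / w x ^ 2) x :=
  (hw.hasDerivAt x).inv (hw.pos x).ne'

theorem hasDerivAt_deriv_inv (hw : IsInnerProfile n γ A w) (hn : 3 ≤ n) (x : ℝ) :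
    HasDerivAt (fun y => -deriv w y / w y ^ 2)
      (-((n : ℝ) - 2) / w x + -deriv w x / w x ^ 2 * w x
        * (((n : ℝ) + 2) / 4 * (-deriv w x / w x ^ 2) - γ * A / ((n : ℝ) - 1))) x := by
  have h0 := (hw.pos x).ne'
  have hn' : (3 : ℝ) ≤ n := by exact_mod_cast hn
  have h1 : (n : ℝ) - 1 ≠ 0 := by linarith
  refine ((hw.hasDerivAt_deriv x).fun_neg.fun_div ((hw.hasDerivAt x).fun_pow 2)
    (pow_ne_zero 2 h0)).congr_deriv ?_
  rw [hw.deriv_deriv_eq hn]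
  field_simp
  ring

theorem hasDerivAt_logDeriv (hw : IsInnerProfile n γ A w) (hn : 3 ≤ n) (x : ℝ) :
    HasDerivAt (fun y => deriv w y / w y)
      (((n : ℝ) - 2) * (1 - (deriv w x / w x) ^ 2 / 4)
        - γ * A / ((n : ℝ) - 1) * w x * (deriv w x / w x)) x := by
  have h0 := (hw.pos x).ne'
  have hn' : (3 : ℝ) ≤ n := by exact_mod_cast hn
  have h1 : (n : ℝ) - 1 ≠ 0 := by linarith
  refine ((hw.hasDerivAt_deriv x).fun_div (hw.hasDerivAt x) h0).congr_deriv ?_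
  rw [hw.deriv_deriv_eq hn]
  field_simp
  ring

/-- The inner profile is strictly increasing: otherwise `1 / w` would become negative at some
point towards `-∞`. -/
theorem deriv_pos (hw : IsInnerProfile n γ A w) (hn : 3 ≤ n) (hγA : 0 < γ * A) (x : ℝ) :
    0 < deriv w x := by
  have hn' : (3 : ℝ) ≤ n := by exact_mod_cast hn
  have hβ : 0 < γ * A / ((n : ℝ) - 1) := div_pos hγA (by linarith)
  set g : ℝ → ℝ := fun y => -deriv w y / w y ^ 2 with hg
  have key : ∀ a, g a ≤ 0 := by
    intro a
    by_contra! ha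
    -- With `ρ` this small, the derivative of `g` is negative wherever `g = ρ`, so `g` cannot drop
    -- below `ρ` when followed leftwards from `a`.
    set ρ := min (g a) (γ * A / ((n : ℝ) - 1) / (((n : ℝ) + 2) / 4)) with hρ
    have hρ0 : 0 < ρ := lt_min ha (by positivity)
    have hρ1 : ((n : ℝ) + 2) / 4 * ρ ≤ γ * A / ((n : ℝ) - 1) := by
      have := min_le_right (g a) (γ * A / ((n : ℝ) - 1) / (((n : ℝ) + 2) / 4))
      rw [← hρ, le_div_iff₀ (by positivity)] at this
      linarith
    have hge : ∀ y, y ≤ a → ρ ≤ g y := by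
      intro y hy
      have := nonneg_of_deriv_neg_at_zeros (f := fun y => g y - ρ) (a := a)
        (fun y _ => (hw.hasDerivAt_deriv_inv hn y).sub_const ρ)
        (sub_nonneg.2 (min_le_left _ _)) (fun y _ h0 => by
          have h0' : -deriv w y / w y ^ 2 = ρ := by simpa [hg] using sub_eq_zero.1 h0
          rw [h0']
          have hp := hw.pos y
          have h1 : -((n : ℝ) - 2) / w y < 0 := div_neg_of_neg_of_pos (by linarith) hp
          have h2 : ρ * w y * (((n : ℝ) + 2) / 4 * ρ - γ * A / ((n : ℝ) - 1)) ≤ 0 :=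
            mul_nonpos_of_nonneg_of_nonpos (by positivity) (by linarith)
          linarith) hy
      linarith
    obtain ⟨y, -, hy⟩ := exists_neg_of_le_deriv (a := a) (fun y _ => hw.hasDerivAt_inv y) hρ0 hge
    exact absurd hy (not_lt.2 (inv_nonneg.2 (hw.pos y).le))
  have hp := hw.pos x
  have h1 : 0 ≤ deriv w x := by
    have := key x
    rw [hg] at this
    simp only [div_le_iff₀ (pow_pos hp 2)] at this
    linarith
  refine h1.lt_of_ne fun h0 => ?_
  -- at a critical point `g = 0` would be a maximum with nonzero derivative
  have hgx : g x = 0 := by simp [hg, ← h0]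
  have hmax : IsLocalMax g x := Eventually.of_forall fun y => by rw [hgx]; exact key y
  have h2 := hmax.hasDerivAt_eq_zero (hw.hasDerivAt_deriv_inv hn x)
  rw [← h0] at h2
  have h3 : -((n : ℝ) - 2) / w x < 0 := div_neg_of_neg_of_pos (by linarith) hp
  simp at h2 h3
  rcases h2 with h2 | h2 <;> linarith

theorem monotone (hw : IsInnerProfile n γ A w) (hn : 3 ≤ n) (hγA : 0 < γ * A) : Monotone w :=
  (strictMono_of_deriv_pos (hw.deriv_pos hn hγA)).monotone

/-! ### Lower bounds for the logarithmic derivative -/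

/-- Towards `-∞`, the logarithmic derivative of the inner profile is bounded below. -/
theorem exists_le_logDeriv_of_nonpos (hw : IsInnerProfile n γ A w) (hn : 3 ≤ n) (hγA : 0 < γ * A) :
    ∃ c > 0, ∀ x ≤ 0, c ≤ deriv w x / w x := by
  have hn' : (3 : ℝ) ≤ n := by exact_mod_cast hn
  have hβ : 0 < γ * A / ((n : ℝ) - 1) := div_pos hγA (by linarith)
  have h0 := hw.pos 0
  set m := γ * A / ((n : ℝ) - 1) * w 0 with hm
  have hm0 : 0 < m := by positivity
  -- Where `u = w' / w ≤ c`, the two bounds defining `c` each cost at most a quarter of `n - 2`,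
  -- whence `u' ≥ (n-2)/2`.
  set c := min 1 (((n : ℝ) - 2) / (4 * m)) with hc
  have hc0 : 0 < c := lt_min one_pos (div_pos (by linarith) (by positivity))
  have hc1 : c ≤ 1 := min_le_left _ _
  have hcm : m * c ≤ ((n : ℝ) - 2) / 4 := by
    have := min_le_right 1 (((n : ℝ) - 2) / (4 * m))
    rw [← hc, le_div_iff₀ (by positivity)] at this
    linarith
  have hu : ∀ x, 0 < deriv w x / w x := fun x => div_pos (hw.deriv_pos hn hγA x) (hw.pos x)
  have hslope : ∀ x ≤ 0, deriv w x / w x ≤ c → ((n : ℝ) - 2) / 2 ≤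
      ((n : ℝ) - 2) * (1 - (deriv w x / w x) ^ 2 / 4)
        - γ * A / ((n : ℝ) - 1) * w x * (deriv w x / w x) := by
    intro x hx hxc
    have h1 : γ * A / ((n : ℝ) - 1) * w x ≤ m :=
      mul_le_mul_of_nonneg_left (hw.monotone hn hγA hx) hβ.le
    have h2 : γ * A / ((n : ℝ) - 1) * w x * (deriv w x / w x) ≤ m * c :=
      mul_le_mul h1 hxc (hu x).le hm0.le
    have h3 : (deriv w x / w x) ^ 2 ≤ 1 := pow_le_one₀ (hu x).le (hxc.trans hc1)
    nlinarith
  refine ⟨c, hc0, fun a ha => ?_⟩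
  by_contra! hac
  -- Below the level `c`, `u` increases, so it stays below `c` to the left of `a`; its slope bound
  -- then forces `u < 0` somewhere.
  have hle : ∀ x ≤ a, deriv w x / w x ≤ c := by
    intro x hx
    have := nonneg_of_deriv_neg_at_zeros (f := fun y => c - deriv w y / w y) (a := a)
      (fun y _ => (hw.hasDerivAt_logDeriv hn y).const_sub c)
      (by linarith) (fun y hy h => by
        have := hslope y (hy.trans ha) (by linarith)
        linarith) hx
    linarith
  obtain ⟨y, -, hy⟩ := exists_neg_of_le_deriv (a := a) (c := ((n : ℝ) - 2) / 2)
    (fun y _ => hw.hasDerivAt_logDeriv hn y) (by linarith)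
    (fun y hy => hslope y (hy.trans ha) (hle y hy))
  exact absurd hy (not_lt.2 (hu y).le)

/-- Beyond some `N` the asymptotic expansion gives linear growth; before `N`, monotonicity gives `w
≤ w N`. -/
theorem exists_le_mul_one_add (hw : IsInnerProfile n γ A w) (hn : 3 ≤ n) (hγA : 0 < γ * A) :
    ∃ B > 0, ∀ x, 0 ≤ x → w x ≤ B * (1 + x) := by
  obtain ⟨c, hc⟩ := hw.asymptotics.bound
  obtain ⟨N, hN⟩ := eventually_atTop.1 (hc.and (eventually_ge_atTop 1))
  set a := ((n : ℝ) - 1) * ((n : ℝ) - 2) / (γ * A)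
  set b := ((n : ℝ) - 1) * ((n : ℝ) - 6) / (4 * γ * A)
  have hwN := hw.pos N
  refine ⟨w N + |a| + |b| + |c|, by positivity, fun x hx => ?_⟩
  rcases le_total x N with h | h
  · have := hw.monotone hn hγA h
    nlinarith [abs_nonneg a, abs_nonneg b, abs_nonneg c]
  · obtain ⟨h1, h2⟩ := hN x h
    rw [Real.norm_eq_abs, Real.norm_eq_abs, abs_of_nonneg (show 0 ≤ 1 / x ^ 2 by positivity)] at h1
    have h3 : 1 / x ≤ 1 := by rw [div_le_one (by linarith)]; exact h2
    have h4 : 1 / x ^ 2 ≤ 1 := by rw [div_le_one (by positivity)]; nlinarith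
    have h5 : c * (1 / x ^ 2) ≤ |c| :=
      (mul_le_mul_of_nonneg_right (le_abs_self c) (by positivity)).trans
        (mul_le_of_le_one_right (abs_nonneg c) h4)
    have h6 : b * (1 / x) ≤ |b| :=
      (mul_le_mul_of_nonneg_right (le_abs_self b) (by positivity)).trans
        (mul_le_of_le_one_right (abs_nonneg b) h3)
    have h7 : a * x ≤ |a| * x := mul_le_mul_of_nonneg_right (le_abs_self a) hx
    have h8 := (le_abs_self _).trans h1
    nlinarith [abs_nonneg a, mul_nonneg (abs_nonneg b) hx, mul_nonneg (abs_nonneg c) hx,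
      mul_nonneg hwN.le hx]

/-- Towards `+∞`, the logarithmic derivative of the inner profile decays at most like `1 / x`. -/
theorem exists_le_logDeriv_of_nonneg (hw : IsInnerProfile n γ A w) (hn : 3 ≤ n) (hγA : 0 < γ * A) :
    ∃ c > 0, ∀ x, 0 ≤ x → c / (1 + x) ≤ deriv w x / w x := by
  have hn' : (3 : ℝ) ≤ n := by exact_mod_cast hn
  have hβ : 0 < γ * A / ((n : ℝ) - 1) := div_pos hγA (by linarith)
  obtain ⟨B, hB0, hB⟩ := hw.exists_le_mul_one_add hn hγA
  have hu : ∀ x, 0 < deriv w x / w x := fun x => div_pos (hw.deriv_pos hn hγA x) (hw.pos x)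
  set m := γ * A / ((n : ℝ) - 1) * B with hm
  have hm0 : 0 < m := by positivity
  -- `c / (1 + x)` starts below `w' / w` at `0`. At a contact point the linear bound on `w` cancels
  -- `1 + x`, leaving slope at least `(n-2)/2` for `w' / w`, while `c / (1 + x)` decreases.
  set c := min (min 1 (deriv w 0 / w 0)) (((n : ℝ) - 2) / (4 * m)) with hc
  have hc0 : 0 < c := lt_min (lt_min one_pos (hu 0)) (div_pos (by linarith) (by positivity))
  have hc1 : c ≤ 1 := (min_le_left _ _).trans (min_le_left _ _)
  have hc2 : c ≤ deriv w 0 / w 0 := (min_le_left _ _).trans (min_le_right _ _)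
  have hcm : m * c ≤ ((n : ℝ) - 2) / 4 := by
    have := min_le_right (min 1 (deriv w 0 / w 0)) (((n : ℝ) - 2) / (4 * m))
    rw [← hc, le_div_iff₀ (by positivity)] at this
    linarith
  refine ⟨c, hc0, fun x hx => ?_⟩
  have := nonneg_of_deriv_pos_at_zeros (f := fun y => deriv w y / w y - c / (1 + y)) (a := 0)
    (fun y hy => (hw.hasDerivAt_logDeriv hn y).fun_sub
      ((hasDerivAt_const y c).fun_div ((hasDerivAt_id' y).const_add 1) (by linarith)))
    (by simpa using hc2) (fun y hy h => by
      have hy1 : 0 < 1 + y := by linarith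
      have h1 : deriv w y / w y = c / (1 + y) := sub_eq_zero.1 h
      have h2 : γ * A / ((n : ℝ) - 1) * w y * (deriv w y / w y) ≤ m * c := by
        rw [h1]
        calc γ * A / ((n : ℝ) - 1) * w y * (c / (1 + y))
            ≤ γ * A / ((n : ℝ) - 1) * (B * (1 + y)) * (c / (1 + y)) := by
              gcongr; exact hB y hy
          _ = m * c := by rw [hm]; field_simp
      have h3 : (deriv w y / w y) ^ 2 ≤ 1 := by
        refine pow_le_one₀ (hu y).le ?_
        rw [h1, div_le_one hy1]
        linarith
      have h4 : (0 * (1 + y) - c * 1) / (1 + y) ^ 2 ≤ 0 :=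
        div_nonpos_of_nonpos_of_nonneg (by linarith) (by positivity)
      nlinarith) hx
  linarith

theorem exists_le_mul_deriv (hw : IsInnerProfile n γ A w) (hn : 3 ≤ n) (hγA : 0 < γ * A) :
    ∃ B > 0, ∀ x r, 0 ≤ r → x ≤ r → w x ≤ B * (1 + r) * deriv w x := by
  obtain ⟨c₁, hc₁, h₁⟩ := hw.exists_le_logDeriv_of_nonpos hn hγA
  obtain ⟨c₂, hc₂, h₂⟩ := hw.exists_le_logDeriv_of_nonneg hn hγA
  refine ⟨1 / c₁ + 1 / c₂, by positivity, fun x r hr hx => ?_⟩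
  have hp := hw.pos x
  have hd := hw.deriv_pos hn hγA x
  have hd₁ : 0 ≤ 1 / c₁ * deriv w x := by positivity
  have hd₂ : 0 ≤ 1 / c₂ * deriv w x := by positivity
  rcases le_total x 0 with h | h
  · have := h₁ x h
    rw [le_div_iff₀ hp] at this
    have h3 : w x ≤ 1 / c₁ * deriv w x := by
      rw [one_div, inv_mul_eq_div, le_div_iff₀ hc₁]; linarith
    nlinarith [mul_nonneg hd₁ hr, mul_nonneg hd₂ hr]
  · have := h₂ x h
    rw [div_le_div_iff₀ (by linarith) hp] at this
    have h3 : w x ≤ 1 / c₂ * deriv w x * (1 + x) := by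
      rw [one_div, inv_mul_eq_div, div_mul_eq_mul_div, le_div_iff₀ hc₂]; linarith
    nlinarith [mul_nonneg hd₁ hr, mul_nonneg hd₂ (sub_nonneg.2 hx)]

/-! ### The operator on the barriers, and growth of the shift -/

/-- The inner operator on a rescaled and shifted inner profile. -/
theorem innerOp_eq (hw : IsInnerProfile n γ A w) {c : ℝ} (hc : c ≠ 0) {C : ℝ → ℝ} {C' τ : ℝ}
    (hC : HasDerivAt C C' τ) (ξ : ℝ) :
    innerOp n γ A (fun ξ τ => c * w (ξ + C τ)) ξ τ =
      Real.exp (-γ * τ) * (c * (deriv w (ξ + C τ) * C' - (1 + γ) * w (ξ + C τ)))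
        + γ * A * (1 - c) * deriv w (ξ + C τ) := by
  have h1 : deriv (fun t => c * w (ξ + C t)) τ = c * (deriv w (ξ + C τ) * C') :=
    (((hw.hasDerivAt (ξ + C τ)).comp τ (hC.const_add ξ)).const_mul c).deriv
  have h2 : deriv (fun x => c * w (x + C τ)) = fun x => c * deriv w (x + C τ) := by
    ext x
    exact (((hw.hasDerivAt (x + C τ)).comp_add_const x (C τ)).const_mul c).deriv
  have h3 : deriv (fun x => c * deriv w (x + C τ)) ξ = c * deriv (deriv w) (ξ + C τ) :=
    (((hw.hasDerivAt_deriv (ξ + C τ)).comp_add_const ξ (C τ)).const_mul c).deriv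
  have ho := hw.ode (ξ + C τ)
  have h0 := (hw.pos (ξ + C τ)).ne'
  simp only [innerOp, h1, h2, h3]
  rw [mul_div_mul_left _ _ hc, mul_pow, mul_pow, mul_div_mul_left _ _ (pow_ne_zero 2 hc)]
  linear_combination -ho

theorem contDiffOn_shift (hw : IsInnerProfile n γ A w) (c : ℝ) {C : ℝ → ℝ} {τ₀ : ℝ}
    (hC : ContDiffOn ℝ ∞ C (Ici τ₀)) {U : Set (ℝ × ℝ)} (hU : ∀ p ∈ U, τ₀ ≤ p.2) :
    ContDiffOn ℝ 2 (fun p : ℝ × ℝ => c * w (p.1 + C p.2)) U := by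
  have h1 : ContDiffOn ℝ 2 (fun p : ℝ × ℝ => C p.2) U :=
    (hC.of_le (WithTop.coe_le_coe.2 (le_top (a := (2 : ℕ∞))))).comp contDiff_snd.contDiffOn hU
  exact contDiffOn_const.mul (hw.contDiff.comp_contDiffOn (contDiff_fst.contDiffOn.add h1))

end IsInnerProfile

theorem IsSlowShift.hasDerivAt {τ₀ M : ℝ} {C : ℝ → ℝ} (hC : IsSlowShift τ₀ M C) {τ : ℝ}
    (hτ : τ₀ < τ) : HasDerivAt C (derivWithin C (Ici τ₀) τ) τ :=
  ((hC.1.differentiableOn (by simp)) τ hτ.le).hasDerivWithinAt.hasDerivAt (Ici_mem_nhds hτ)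

theorem IsSlowShift.le_add {τ₀ M : ℝ} {C : ℝ → ℝ} (hC : IsSlowShift τ₀ M C) {τ : ℝ}
    (hτ : τ₀ ≤ τ) : C τ ≤ C τ₀ + M * (τ - τ₀) := by
  have := (convex_Ici τ₀).norm_image_sub_le_of_norm_derivWithin_le
    (hC.1.differentiableOn (by simp)) (fun x hx => hC.2 x hx) self_mem_Ici hτ
  rw [Real.norm_eq_abs, Real.norm_eq_abs, abs_of_nonneg (sub_nonneg.2 hτ)] at this
  linarith [le_abs_self (C τ - C τ₀)]

theorem tendsto_exp_neg_mul_mul_affine {γ : ℝ} (hγ : 0 < γ) (P Q : ℝ) :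
    Tendsto (fun τ : ℝ => Real.exp (-γ * τ) * (P + Q * τ)) atTop (𝓝 0) := by
  have h1 : Tendsto (fun τ : ℝ => γ * τ) atTop atTop := tendsto_id.const_mul_atTop hγ
  have h2 := (Real.tendsto_pow_mul_exp_neg_atTop_nhds_zero 0).comp h1
  have h3 := (Real.tendsto_pow_mul_exp_neg_atTop_nhds_zero 1).comp h1
  have h4 := (h2.const_mul P).add (h3.const_mul (Q / γ))
  simp only [mul_zero, add_zero] at h4
  refine h4.congr fun τ => ?_
  simp only [Function.comp, pow_zero, pow_one, one_mul, neg_mul]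
  field_simp

theorem mainTheorem9 (n : ℕ) (hn : 3 ≤ n) (γ A : ℝ) (hγ : 0 < γ) (hA : 0 < A)
    (w₀ : ℝ → ℝ) (hw₀ : IsInnerProfile n γ A w₀)
    (ε : ℝ) (hε₀ : 0 < ε) (hε₁ : ε < 1) (τ₀ M ξ₁ : ℝ) :
    (∀ K : ℝ, ∃ τ₁ : ℝ, τ₀ ≤ τ₁ ∧ ∀ C₁ : ℝ → ℝ, IsSlowShift τ₀ M C₁ → C₁ τ₀ ≤ K →
      IsInnerSuperSolutionOn n γ A (upperBarrier w₀ ε C₁) (Iio ξ₁ ×ˢ Ioi τ₁)) ∧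
    (∃ τ₁ : ℝ, τ₀ ≤ τ₁ ∧ ∀ C₂ : ℝ → ℝ, IsSlowShift τ₀ M C₂ →
      IsInnerSubSolutionOn n γ A (lowerBarrier w₀ ε C₂) (Iio ξ₁ ×ˢ Ioi τ₁)) := by
  have hγA : 0 < γ * A := mul_pos hγ hA
  have hδ : 0 < γ * A * ε := mul_pos hγA hε₀
  constructor
  · intro K
    obtain ⟨B, hB0, hB⟩ := hw₀.exists_le_mul_deriv hn hγA
    -- The affine function is `M + (1+γ) B (1+r)` with `r = |ξ₁| + |K| + M (τ - τ₀)`, an upper bound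
    -- for `ξ + C τ`. It does not involve `C`, so neither does `τ₁`.
    have hev := (tendsto_exp_neg_mul_mul_affine hγ
      (M + (1 + γ) * (B * (1 + (|ξ₁| + |K| - M * τ₀)))) ((1 + γ) * (B * M))).eventually_lt_const hδ
    obtain ⟨T, hT⟩ := eventually_atTop.1 hev
    refine ⟨max τ₀ T, le_max_left _ _, fun C hC hCK => ?_⟩
    have hc : 0 < 1 / (1 + ε) := by positivity
    refine ⟨hw₀.contDiffOn_shift _ hC.1 fun p hp => (le_max_left _ _).trans hp.2.le,
      fun p _ => mul_pos hc (hw₀.pos _), ?_⟩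
    rintro ⟨ξ, τ⟩ ⟨hξ, hτ⟩
    simp only [mem_Iio, mem_Ioi, max_lt_iff] at hξ hτ
    have heq := hw₀.innerOp_eq hc.ne' (hC.hasDerivAt hτ.1) ξ
    change 0 < innerOp n γ A (fun ξ τ => 1 / (1 + ε) * w₀ (ξ + C τ)) ξ τ
    rw [heq]
    have hM := hC.2 τ hτ.1.le
    have hM0 : 0 ≤ M := (abs_nonneg _).trans hM
    have hd := hw₀.deriv_pos hn hγA (ξ + C τ)
    have hr : 0 ≤ |ξ₁| + |K| + M * (τ - τ₀) := by
      have := mul_nonneg hM0 (sub_nonneg.2 hτ.1.le)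
      positivity
    have hw := hB (ξ + C τ) _ hr (by
      linarith [hC.le_add hτ.1.le, le_abs_self ξ₁, le_abs_self K])
    have hlt := mul_lt_mul_of_pos_right (hT τ hτ.2.le) hd
    set D := deriv w₀ (ξ + C τ)
    have h1 : -(M * D) ≤ D * derivWithin C (Ici τ₀) τ := by
      nlinarith [neg_abs_le (derivWithin C (Ici τ₀) τ)]
    have h2 := mul_le_mul_of_nonneg_left hw (by linarith : 0 ≤ 1 + γ)
    have h3 := mul_le_mul_of_nonneg_left (add_le_add h1 (neg_le_neg h2)) (Real.exp_pos (-γ * τ)).le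
    have h4 : 1 - 1 / (1 + ε) = 1 / (1 + ε) * ε := by field_simp; ring
    rw [h4]
    have h5 : 0 < 1 / (1 + ε) * (Real.exp (-γ * τ) * (D * derivWithin C (Ici τ₀) τ
        - (1 + γ) * w₀ (ξ + C τ)) + γ * A * ε * D) := mul_pos hc (by linarith)
    linarith
  -- Only the `C'` term has to be absorbed, so no bound on `C` itself enters.
  · have hev := (tendsto_exp_neg_mul_mul_affine hγ M 0).eventually_lt_const hδ
    obtain ⟨T, hT⟩ := eventually_atTop.1 hev
    refine ⟨max τ₀ T, le_max_left _ _, fun C hC => ?_⟩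
    have hε : 0 < 1 - ε := by linarith
    have hc : 0 < 1 / (1 - ε) := by positivity
    refine ⟨hw₀.contDiffOn_shift _ hC.1 fun p hp => (le_max_left _ _).trans hp.2.le,
      fun p _ => mul_pos hc (hw₀.pos _), ?_⟩
    rintro ⟨ξ, τ⟩ ⟨hξ, hτ⟩
    simp only [mem_Iio, mem_Ioi, max_lt_iff] at hξ hτ
    have heq := hw₀.innerOp_eq hc.ne' (hC.hasDerivAt hτ.1) ξ
    change innerOp n γ A (fun ξ τ => 1 / (1 - ε) * w₀ (ξ + C τ)) ξ τ < 0
    rw [heq]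
    have hM := hC.2 τ hτ.1.le
    have hd := hw₀.deriv_pos hn hγA (ξ + C τ)
    have hlt := mul_lt_mul_of_pos_right (hT τ hτ.2.le) hd
    have hw : 0 < (1 + γ) * w₀ (ξ + C τ) := mul_pos (by linarith) (hw₀.pos _)
    set D := deriv w₀ (ξ + C τ)
    have h1 : D * derivWithin C (Ici τ₀) τ ≤ M * D := by
      nlinarith [le_abs_self (derivWithin C (Ici τ₀) τ)]
    have h3 := mul_le_mul_of_nonneg_left (add_le_add h1 (neg_le_neg hw.le))
      (Real.exp_pos (-γ * τ)).le
    have h4 : 1 - 1 / (1 - ε) = -(1 / (1 - ε) * ε) := by field_simp; ring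
    rw [h4]
    have h5 : 0 < 1 / (1 - ε) * (γ * A * ε * D - Real.exp (-γ * τ) *
        (D * derivWithin C (Ici τ₀) τ - (1 + γ) * w₀ (ξ + C τ))) := mul_pos hc (by linarith)
    linarith
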